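/- Let $V$ be a finite set of nodes. An oblivious network model $M$ on $V$ is the law of a random sequence $E_1,E_2,\dots\subseteq V\times V$ of active edge sets (the joint law is arbitrary: $E_t$ may depend on $t$, on $E_{t'}$ for $t'<t$, and on randomness). For $p\in[0,1]$ and $S\subseteq V$, the flooding process $F(M,p,S)$ is $S_1\subseteq S_2\subseteq\cdots$ with $S_1=S$ and $S_{t+1}=S_t\cup\{v : \exists u\in S_t,\ (u,v)\in E'_t\}$, where $E'_t$ keeps each edge of $E_t$ independently with probability $1-p$ (independently over all edges and rounds, and of the choice of the $E_t$). Let $S_F=\inf\{t : S_t=V\}\in\{1,2,\dots\}\cup\{\infty\}$. For $T\in\mathbb R$ and $\alpha>0$, $M$ *floods in time $T$ with throughput $\alpha$* if there is a prime power $q$ such that $P[S_{F(M,1/q,\{v\})}\ge T+k]<q^{-\alpha k}$ for every $v\in V$ and every integer $k>0$. Given edge sets $E_1,\dots,E_{T'}$, a path from $s$ to $d$ is a sequence $(v_0,\dots,v_{T'})$ of nodes with $v_0=s$, $v_{T'}=d$ and, for every $1\le t\le T'$, $v_{t-1}=v_t$ or $(v_{t-1},v_t)\in E_t$. A finite family of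 paths with nonnegative weights is valid if for every $1\le t\le T'$ and every $(u,v)\in E_t$ with $u\ne v$ the weights of the paths with $(v_{t-1},v_t)=(u,v)$ sum to at most $1$. A family achieves capacity $c$ between $s$ and $d$ if the weights of its paths from $s$ to $d$ sum to $c$. **Lemma.** Let $M$ be an oblivious network model on $V$ that floods in time $T$ with throughput $\alpha>0$. Let $T'\in\mathbb N$, $\epsilon>0$, let $d\in V$ be a sink and let $s_1,\dots,s_k\in V$ be sources with real rates $c_1,\dots,c_k>0$. If $$T'\ \ge\ T+\frac1\alpha\Big(\Big\lceil\sum_{i=1}^k c_i\Big\rceil+\log_2 k+\log_2\epsilon^{-1}\Big)$$ (with $\log_2 k$ read as $0$ if $k=0$), then with probability at least $1-\epsilon$ over $E_1,\dots,E_{T'}$ sampled from $M$ there are finite families $\mathcal P_1,\dots,\mathcal P_k$ of weighted paths such that, for every $i$, $\mathcal P_i$ consists of paths from $s_i$ to $d$ and achieves capacity $c_i$ between $s_i$ and $d$, and the union of $\mathcal P_1,\dots,\mathcal P_k$ (as a family, with multiplicity) is valid. -/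

import Mathlib

open MeasureTheory ProbabilityTheory

namespace NetworkGossip

/-- An oblivious network model on the node set `V`: the law of an infinite random sequence of
sets of directed edges.  Coordinate `t` of a sequence is the active edge set of round `t + 1`.
An arbitrary joint law is allowed, that is, the edge set of a round may depend in any way on the
round, on the edge sets of the earlier rounds and on randomness, and on nothing else. -/
structure ObliviousModel (V : Type*) where
  /-- The joint law of the active edge sets of all rounds. -/
  law : Measure (ℕ → Set (V × V))
  isProbabilityMeasure_law : IsProbabilityMeasure law

/-- One sample path of flooding.  `E t` is the active edge set of round `t + 1`,
`fault (t, u, v) = true` means that the transmission along `(u, v)` in round `t + 1` is lost, and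
`floodSet E fault S t` is the set of informed nodes after `t` rounds, if the nodes of `S` are
informed at the start. -/
def floodSet {V : Type*} (E : ℕ → Set (V × V)) (fault : ℕ × V × V → Bool) (S : Set V) :
    ℕ → Set V
  | 0 => S
  | t + 1 => {v | v ∈ floodSet E fault S t ∨
      ∃ u ∈ floodSet E fault S t, (u, v) ∈ E t ∧ fault (t, u, v) = false}

/-- The time at which flooding stops, i.e. reaches the state in which all nodes are informed
(`⊤` if it never does).  The process is indexed by the times `1, 2, …`; its state at time `1` is
the starting set `S`, so that `t` rounds have been completed at time `t + 1`. -/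
noncomputable def floodTime {V : Type*} (S : Set V)
    (ω : (ℕ → Set (V × V)) × (ℕ × V × V → Bool)) : ℕ∞ :=
  ⨅ (t : ℕ) (_ : floodSet ω.1 ω.2 S t = Set.univ), ((t + 1 : ℕ) : ℕ∞)

/-- The probability space of the flooding process with fault probability `p`: the active edges
follow the model, and, independently of them, each edge in each round has its own independent
fault, of probability `p`. -/
noncomputable def ObliviousModel.floodLaw {V : Type*} (M : ObliviousModel V) (p : unitInterval) :
    Measure ((ℕ → Set (V × V)) × (ℕ × V × V → Bool)) :=
  M.law.prod (Measure.infinitePi fun _ : ℕ × V × V => bernoulliMeasure true false p)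

/-- The fault probability `1 / q`. -/
noncomputable def faultProb (q : ℕ) : unitInterval :=
  ⟨1 / (q : ℝ), by positivity, by rw [one_div]; exact Nat.cast_inv_le_one q⟩

/-- The model floods in time `T` with throughput `α`: for some prime power `q`, for every node
`v` and every `k > 0`, `P[S_F ≥ T + k] < q ^ (- α k)` for the flooding process `F` with fault
probability `1 / q` and starting set `{v}`. -/
def ObliviousModel.FloodsInTime {V : Type*} (M : ObliviousModel V) (T α : ℝ) : Prop :=
  ∃ q : ℕ, IsPrimePow q ∧ ∀ (v : V) (k : ℕ), 0 < k →
    (M.floodLaw (faultProb q)).real {ω | ENNReal.ofReal (T + k) ≤ (floodTime {v} ω : ENNReal)} <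
      (q : ℝ) ^ (-(α * k))

/-- A path through the active edge sets of `T` rounds: in each round it stays where it is or
follows an active edge. -/
def IsPath {V : Type*} {T : ℕ} (E : Fin T → Set (V × V)) (P : Fin (T + 1) → V) : Prop :=
  ∀ t : Fin T, P t.castSucc = P t.succ ∨ (P t.castSucc, P t.succ) ∈ E t

/-- The node sequence `P` goes from `s` to `d`. -/
def IsFromTo {V : Type*} {T : ℕ} (P : Fin (T + 1) → V) (s d : V) : Prop :=
  P 0 = s ∧ P (Fin.last T) = d

open Classical in
/-- A finite family of paths `P j` with nonnegative weights `w j` is valid if for each round and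
each edge that is active in this round, the weights of the paths that use the edge in this round
sum to at most one.  (A path that stays at a node uses no edge, so only edges between distinct
nodes are constrained.) -/
def IsValid {V ι : Type*} [Fintype ι] {T : ℕ} (E : Fin T → Set (V × V))
    (P : ι → Fin (T + 1) → V) (w : ι → ℝ) : Prop :=
  (∀ j, IsPath E (P j)) ∧ (∀ j, 0 ≤ w j) ∧
    ∀ (t : Fin T) (u v : V), u ≠ v → (u, v) ∈ E t →
      ∑ j with P j t.castSucc = u ∧ P j t.succ = v, w j ≤ 1

open Classical in
/-- A finite family of weighted paths achieves the capacity `c` between `s` and `d` if the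
weights of its paths from `s` to `d` sum to `c`. -/
def AchievesCapacity {V ι : Type*} [Fintype ι] {T : ℕ} (P : ι → Fin (T + 1) → V) (w : ι → ℝ)
    (s d : V) (c : ℝ) : Prop :=
  ∑ j with IsFromTo (P j) s d, w j = c

/-- In the active edge sets `E` there is a selection of weighted paths, valid altogether, that
achieves the capacity `c i` between `s i` and `d` for every `i`: it consists of a finite family
of paths from `s i` to `d` for every `i`, which may share the edges with the other families.
If the sources are distinct, the union of the families is a single valid family of weighted paths
whose paths from `s i` to `d` have total weight `c i`; if sources coincide, their demands add. -/
def CapacitiesAchievable {V : Type*} {T k : ℕ} (E : Fin T → Set (V × V)) (s : Fin k → V) (d : V)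
    (c : Fin k → ℝ) : Prop :=
  ∃ (m : Fin k → ℕ) (P : (i : Fin k) → Fin (m i) → Fin (T + 1) → V)
    (w : (i : Fin k) → Fin (m i) → ℝ),
    IsValid E (fun j : (i : Fin k) × Fin (m i) => P j.1 j.2) (fun j => w j.1 j.2) ∧
      ∀ i, (∀ j, IsFromTo (P i j) (s i) d) ∧ AchievesCapacity (P i) (w i) (s i) d (c i)

end NetworkGossip

namespace NetworkGossip

/-! Two arguments meet at the cuts of the time-expanded network.

Probability: given the edge sets, a cut between `s` and `d` with at most `N` edges has all of them
faulty with probability at least `q ^ (-N)`, and then flooding from `s` misses `d`. Slow flooding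
has probability below `q ^ (-α m)`, so a small cut is rarer still by the factor `q ^ N`
(`smallCut_le`, `smallCut_lt`). Only the existence of a small cut matters, so no union over cuts is
needed, only one over sources.

Duality: if every cut between any single source and `d` has at least `∑ c` edges, all demands can be
routed together (`capacitiesAchievable_of_cuts`). Otherwise a hyperplane separates the achievable
loads from the unit capacities; its coefficients are edge lengths `y ≥ 0` with `∑ y` less than the
total cost `∑ c i * dist i`. That cost is at most `∑ c` times the largest distance, and threshold
cuts around the farthest source bound this by `∑ y` (`mul_le_sum_of_cuts`). -/

/-- An increasing sequence of node sets that contains `s` at the start and misses `d` at the end: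
a cut of the time-expanded network in which waiting at a node is free. -/
structure IsCut {V : Type*} {T : ℕ} (s d : V) (U : Fin (T + 1) → Set V) : Prop where
  source_mem : s ∈ U 0
  sink_notMem : d ∉ U (Fin.last T)
  mono : ∀ t : Fin T, U t.castSucc ⊆ U t.succ

open Classical in
/-- The active edges that leave the cut `U`. -/
noncomputable def cutEdges {V : Type*} [Fintype V] {T : ℕ} (E : Fin T → Set (V × V))
    (U : Fin (T + 1) → Set V) : Finset (Fin T × V × V) :=
  {e | e.2 ∈ E e.1 ∧ e.2.1 ∈ U e.1.castSucc ∧ e.2.2 ∉ U e.1.succ}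

/-! ### Lengths, distances and threshold cuts -/

open Classical in
/-- The length of a node sequence for the edge lengths `y`; waiting costs nothing. -/
noncomputable def pathLength {V : Type*} {T : ℕ} (y : Fin T × V × V → ℝ)
    (P : Fin (T + 1) → V) : ℝ :=
  ∑ t : Fin T, if P t.castSucc = P t.succ then 0 else y (t, P t.castSucc, P t.succ)

open Classical in
/-- The distance from `s`, truncated at `Z`, in the time-expanded network. -/
noncomputable def potential {V : Type*} [Fintype V] {T : ℕ} (E : Fin T → Set (V × V))
    (y : Fin T × V × V → ℝ) (s : V) (Z : ℝ) : Fin (T + 1) → V → ℝ :=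
  Fin.induction (fun v => if v = s then 0 else Z) fun t φ v =>
    Finset.univ.inf' ⟨s, Finset.mem_univ s⟩ fun u =>
      if u ≠ v ∧ (u, v) ∈ E t then φ u + y (t, u, v) else φ v

section Potential

variable {V : Type*} [Fintype V] {T : ℕ} (E : Fin T → Set (V × V))
  (y : Fin T × V × V → ℝ) (s : V) (Z : ℝ)

open Classical in
theorem potential_zero (v : V) : potential E y s Z 0 v = if v = s then 0 else Z := by
  simp [potential]

open Classical in
theorem potential_succ (t : Fin T) (v : V) :
    potential E y s Z t.succ v = Finset.univ.inf' ⟨s, Finset.mem_univ s⟩ fun u =>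
      if u ≠ v ∧ (u, v) ∈ E t then potential E y s Z t.castSucc u + y (t, u, v)
      else potential E y s Z t.castSucc v := by
  simp [potential]

/-- The index `u = v` in the infimum is the free wait; this is what makes sublevel sets of the
potential increase in time. -/
theorem potential_succ_le (t : Fin T) (v : V) :
    potential E y s Z t.succ v ≤ potential E y s Z t.castSucc v := by
  rw [potential_succ]
  exact (Finset.inf'_le _ (Finset.mem_univ v)).trans (by simp)

theorem potential_edge_le (hy : ∀ e, 0 ≤ y e) (t : Fin T) {u v : V} (h : (u, v) ∈ E t) :
    potential E y s Z t.succ v ≤ potential E y s Z t.castSucc u + y (t, u, v) := by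
  by_cases huv : u = v
  · subst huv
    linarith [potential_succ_le E y s Z t u, hy (t, u, u)]
  · rw [potential_succ]
    exact (Finset.inf'_le _ (Finset.mem_univ u)).trans (by simp [huv, h])

/-- A value below the truncation level `Z` must trace back to `s`. The path waits at `v` from time
`t` on, so that it can be redirected in the induction. -/
theorem exists_path_of_potential_lt (hy : ∀ e, 0 ≤ y e) (t : Fin (T + 1)) :
    ∀ v, potential E y s Z t v < Z → ∃ P : Fin (T + 1) → V, IsPath E P ∧ P 0 = s ∧
      (∀ i, t ≤ i → P i = v) ∧ pathLength y P ≤ potential E y s Z t v := by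
  classical
  induction t using Fin.induction with
  | zero =>
    intro v hv
    rw [potential_zero] at hv ⊢
    split_ifs at hv ⊢ with h
    · exact ⟨fun _ => v, fun _ => Or.inl rfl, h, fun _ _ => rfl, by simp [pathLength]⟩
    · exact absurd hv (lt_irrefl _)
  | succ t ih =>
    intro v hv
    obtain ⟨u, -, hu⟩ := Finset.exists_mem_eq_inf' ⟨s, Finset.mem_univ s⟩ fun u =>
      if u ≠ v ∧ (u, v) ∈ E t then potential E y s Z t.castSucc u + y (t, u, v)
      else potential E y s Z t.castSucc v
    rw [← potential_succ] at hu
    rw [hu] at hv ⊢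
    split_ifs at hv ⊢ with h
    · obtain ⟨P, hP, hP0, hPt, hPl⟩ := ih u (by linarith [hy (t, u, v)])
      have hcs : ∀ i : Fin T, i < t → i.castSucc ≤ t.castSucc ∧ i.succ ≤ t.castSucc := by
        intro i hi
        simp only [Fin.le_def, Fin.lt_def, Fin.val_castSucc, Fin.val_succ] at *
        omega
      have hgt : ∀ i : Fin T, t < i → ¬ i.castSucc ≤ t.castSucc ∧ ¬ i.succ ≤ t.castSucc := by
        intro i hi
        simp only [Fin.le_def, Fin.lt_def, Fin.val_castSucc, Fin.val_succ] at *
        omega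
      have ht : ¬ t.succ ≤ t.castSucc := by
        simp [Fin.le_def]
      refine ⟨fun i => if i ≤ t.castSucc then P i else v, ?_, ?_, ?_, ?_⟩
      · intro i
        rcases lt_trichotomy i t with hi | rfl | hi
        · simpa [hcs i hi] using hP i
        · right
          simpa [ht, hPt _ le_rfl] using h.2
        · left
          simp [hgt i hi]
      · simp [hP0]
      · intro i hi
        have : ¬ i ≤ t.castSucc := by
          simp only [Fin.le_def, Fin.val_castSucc, Fin.val_succ] at *
          omega
        simp [this]
      · have hsum : pathLength y P + y (t, u, v) =
            ∑ i : Fin T, ((if P i.castSucc = P i.succ then 0 else y (i, P i.castSucc, P i.succ)) +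
              if i = t then y (t, u, v) else 0) := by
          rw [Finset.sum_add_distrib]
          simp [pathLength]
        refine le_trans ?_ (add_le_add_left hPl _)
        rw [hsum, pathLength]
        refine Finset.sum_le_sum fun i _ => ?_
        rcases lt_trichotomy i t with hi | rfl | hi
        · simp [hcs i hi, hi.ne]
        · have h1 : P i.succ = u := hPt _ (Fin.castSucc_lt_succ).le
          simp [ht, hPt _ le_rfl, h1, h.1]
        · have : 0 ≤ if P i.castSucc = P i.succ then 0 else y (i, P i.castSucc, P i.succ) := by
            split_ifs
            exacts [le_rfl, hy _]
          simpa [hgt i hi, hi.ne'] using this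
    · obtain ⟨P, hP, hP0, hPt, hPl⟩ := ih v hv
      exact ⟨P, hP, hP0, fun i hi => hPt i ((Fin.castSucc_lt_succ).le.trans hi), hPl⟩

/-- Weak duality between lengths and cuts: if every path from `s` to `d` has length at least `Z`
and every cut has at least `C` edges, then the total length is at least `Z * C`. -/
theorem mul_le_sum_of_cuts (hy : ∀ e, 0 ≤ y e) (d : V) (hZ : 0 < Z) (C : ℝ)
    (hlen : ∀ P, IsPath E P → IsFromTo P s d → Z ≤ pathLength y P)
    (hcut : ∀ U, IsCut s d U → C ≤ (cutEdges E U).card) : Z * C ≤ ∑ e, y e := by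
  classical
  set φ := potential E y s Z with hφ
  have hd : Z ≤ φ (Fin.last T) d := by
    by_contra! h
    obtain ⟨P, hP, hP0, hPt, hPl⟩ := exists_path_of_potential_lt E y s Z hy _ d h
    linarith [hlen P hP ⟨hP0, hPt _ le_rfl⟩]
  let F : Finset (Fin T × V × V) := {e | e.2 ∈ E e.1}
  let J : Fin T × V × V → Set ℝ := fun e => Set.Ico (φ e.1.castSucc e.2.1) (φ e.1.succ e.2.2)
  have hlevel : ∀ θ ∈ Set.Ico 0 Z, ENNReal.ofReal C ≤ ∑ e ∈ F, (J e).indicator 1 θ := by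
    intro θ hθ
    -- The sublevel sets at `θ` form a cut, and an active edge leaves it exactly when `θ` lies in `J
    -- e`, an interval of length at most `y e`. Integrating the edge count over `θ` in `[0, Z)`
    -- gives the bound.
    have hU := hcut (fun t => {v | φ t v ≤ θ})
      ⟨by simpa [hφ, potential_zero] using hθ.1, by simpa using hθ.2.trans_le hd,
        fun t v hv => (potential_succ_le E y s Z t v).trans hv⟩
    have : ∑ e ∈ F, (J e).indicator (1 : ℝ → ENNReal) θ =
        ((cutEdges E fun t => {v | φ t v ≤ θ}).card : ENNReal) := by
      simp only [Set.indicator_apply, Pi.one_apply]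
      rw [Finset.sum_boole, Finset.filter_filter]
      congr 2
      ext e
      simp [cutEdges, J]
    rw [this, ← ENNReal.ofReal_natCast]
    exact ENNReal.ofReal_le_ofReal hU
  have h1 : ∫⁻ _ in Set.Ico 0 Z, ENNReal.ofReal C ≤ ∑ e ∈ F, ENNReal.ofReal (y e) := by
    calc ∫⁻ _ in Set.Ico 0 Z, ENNReal.ofReal C
        ≤ ∫⁻ θ in Set.Ico 0 Z, ∑ e ∈ F, (J e).indicator 1 θ :=
          setLIntegral_mono' measurableSet_Ico hlevel
      _ ≤ ∫⁻ θ, ∑ e ∈ F, (J e).indicator 1 θ := setLIntegral_le_lintegral _ _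
      _ = ∑ e ∈ F, ∫⁻ θ, (J e).indicator 1 θ :=
          lintegral_finsetSum _ fun e _ => measurable_one.indicator measurableSet_Ico
      _ ≤ ∑ e ∈ F, ENNReal.ofReal (y e) := by
          refine Finset.sum_le_sum fun e he => ?_
          rw [lintegral_indicator_one measurableSet_Ico, Real.volume_Ico]
          refine ENNReal.ofReal_le_ofReal ?_
          have := potential_edge_le E y s Z hy e.1 (u := e.2.1) (v := e.2.2)
            (by simpa [F] using he)
          rw [sub_le_iff_le_add']
          exact this
  rw [setLIntegral_const, Real.volume_Ico, sub_zero, mul_comm,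
    ← ENNReal.ofReal_mul hZ.le, ← ENNReal.ofReal_sum_of_nonneg fun e _ => hy e] at h1
  rw [ENNReal.ofReal_le_ofReal_iff (Finset.sum_nonneg fun e _ => hy e)] at h1
  exact h1.trans (Finset.sum_le_univ_sum_of_nonneg hy)

end Potential

/-! ### Routing all sources at once by separation -/

/-- The node sequence `P` moves along the edge `e`. -/
def Uses {V : Type*} {T : ℕ} (P : Fin (T + 1) → V) (e : Fin T × V × V) : Prop :=
  e.2.1 ≠ e.2.2 ∧ P e.1.castSucc = e.2.1 ∧ P e.1.succ = e.2.2

open Classical in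
/-- The load that the node sequences `g i`, taken with weights `c i`, put on each edge. -/
noncomputable def load {V : Type*} {T k : ℕ} (c : Fin k → ℝ) (g : Fin k → Fin (T + 1) → V)
    (e : Fin T × V × V) : ℝ :=
  ∑ i, c i * if Uses (g i) e then 1 else 0

open Classical in
theorem pathLength_eq_sum_uses {V : Type*} [Fintype V] {T : ℕ} (y : Fin T × V × V → ℝ)
    (P : Fin (T + 1) → V) : pathLength y P = ∑ e, if Uses P e then y e else 0 := by
  rw [Fintype.sum_prod_type, pathLength]
  refine Finset.sum_congr rfl fun t _ => ?_
  split_ifs with h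
  · refine (Finset.sum_eq_zero fun e _ => if_neg ?_).symm
    rintro ⟨h1, h2, h3⟩
    exact h1 (h2.symm.trans (h.trans h3))
  · rw [Finset.sum_eq_single (P t.castSucc, P t.succ)]
    · simp [Uses, h]
    · rintro e - he
      refine if_neg ?_
      rintro ⟨-, h2, h3⟩
      exact he (Prod.ext h2.symm h3.symm)
    · simp

theorem sum_load_mul {V : Type*} [Fintype V] {T k : ℕ} (c : Fin k → ℝ)
    (g : Fin k → Fin (T + 1) → V) (y : Fin T × V × V → ℝ) :
    ∑ e, load c g e * y e = ∑ i, c i * pathLength y (g i) := by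
  classical
  simp_rw [pathLength_eq_sum_uses, load, Finset.sum_mul, Finset.mul_sum]
  rw [Finset.sum_comm]
  refine Finset.sum_congr rfl fun i _ => Finset.sum_congr rfl fun e _ => ?_
  split_ifs <;> simp

/-- A convex combination of choices of one path per source whose load is at most one on each edge
gives a valid selection of paths. -/
theorem capacitiesAchievable_of_mem_convexHull {V : Type*} {T k : ℕ} {E : Fin T → Set (V × V)}
    {s : Fin k → V} {d : V} {c : Fin k → ℝ} (hc : ∀ i, 0 < c i) {x : Fin T × V × V → ℝ}
    (hx : x ∈ convexHull ℝ (load c '' {g | ∀ i, IsPath E (g i) ∧ IsFromTo (g i) (s i) d}))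
    (hx1 : ∀ e, x e ≤ 1) : CapacitiesAchievable E s d c := by
  classical
  obtain ⟨ι, _, w, z, hw, hw1, hz, rfl⟩ := mem_convexHull_iff_exists_fintype.1 hx
  choose g hg hgz using hz
  let a : Fin (Fintype.card ι) ≃ ι := (Fintype.equivFin ι).symm
  -- Each joint choice in the convex combination contributes one path per source, with the
  -- coefficient scaled by the demand `c i`.
  refine ⟨fun _ => Fintype.card ι, fun i j => g (a j) i, fun i j => c i * w (a j),
    ⟨fun j => (hg _ _).1, fun j => mul_nonneg (hc _).le (hw _), ?_⟩, fun i => ⟨fun j => (hg _ i).2, ?_⟩⟩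
  · intro t u v huv _
    refine le_trans (le_of_eq ?_) (hx1 (t, u, v))
    rw [Finset.sum_filter, Fintype.sum_sigma, Finset.sum_apply, ← a.sum_comp, Finset.sum_comm]
    refine Finset.sum_congr rfl fun j _ => ?_
    rw [Pi.smul_apply, ← hgz, load, smul_eq_mul, Finset.mul_sum]
    refine Finset.sum_congr rfl fun i _ => ?_
    simp only [Uses, ne_eq, huv, not_false_eq_true, true_and]
    split_ifs <;> ring
  · rw [AchievesCapacity, Finset.filter_true_of_mem fun j _ => (hg _ i).2, ← Finset.mul_sum,
      a.sum_comp w, hw1, mul_one]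

/-- Cuts for single sources suffice, because the cost of a joint routing is bounded through the
farthest source alone. -/
theorem capacitiesAchievable_of_cuts {V : Type*} [Fintype V] {T k : ℕ} {E : Fin T → Set (V × V)}
    {s : Fin k → V} {d : V} {c : Fin k → ℝ} (hc : ∀ i, 0 < c i)
    (hcut : ∀ i U, IsCut (s i) d U → ∑ j, c j ≤ (cutEdges E U).card) :
    CapacitiesAchievable E s d c := by
  classical
  set G : Set (Fin k → Fin (T + 1) → V) := {g | ∀ i, IsPath E (g i) ∧ IsFromTo (g i) (s i) d}
  by_contra hno
  have hdisj : Disjoint {x : Fin T × V × V → ℝ | ∀ e, x e ≤ 1} (convexHull ℝ (load c '' G)) := by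
    rw [Set.disjoint_left]
    exact fun x hx1 hx => hno (capacitiesAchievable_of_mem_convexHull hc hx hx1)
  have hbox : {x : Fin T × V × V → ℝ | ∀ e, x e ≤ 1} = Set.Iic 1 := rfl
  rw [hbox] at hdisj
  obtain ⟨f, u, v, hu, huv, hv⟩ := geometric_hahn_banach_closed_compact (convex_Iic (𝕜 := ℝ) _)
    isClosed_Iic (convex_convexHull ℝ _) ((G.toFinite.image _).isCompact_convexHull ℝ) hdisj
  set y : Fin T × V × V → ℝ := fun e => f (Pi.single e 1)
  have hf : ∀ x, f x = ∑ e, x e * y e := by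
    intro x
    conv_lhs => rw [pi_eq_sum_univ' x]
    rw [map_sum]
    refine Finset.sum_congr rfl fun e _ => ?_
    rw [map_smul, smul_eq_mul]
  have hf1 : f 1 = ∑ e, y e := by simp [hf]
  have hf1u : f 1 < u := hu 1 (Set.mem_Iic.2 le_rfl)
  have hy : ∀ e, 0 ≤ y e := by
    intro e
    by_contra! he
    -- The box is unbounded below: were `y e` negative, lowering coordinate `e` of `1` by this
    -- amount would raise `f` to exactly `u`.
    have hr : 0 ≤ (u - f 1) / (-y e) := div_nonneg (by linarith) (by linarith)
    have := hu (1 - ((u - f 1) / (-y e)) • Pi.single e 1) (by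
      rw [Set.mem_Iic, sub_le_self_iff]
      exact smul_nonneg hr (Pi.single_nonneg.2 zero_le_one))
    rw [map_sub, map_smul, smul_eq_mul] at this
    have h2 : (u - f 1) / (-y e) * f (Pi.single e 1) = -(u - f 1) := by
      change (u - f 1) / (-y e) * y e = _
      field_simp [he.ne]
    linarith
  have hsum_pos : ∀ i : Fin k, 0 < ∑ j, c j := fun i =>
    Finset.sum_pos (fun j _ => hc j) ⟨i, Finset.mem_univ i⟩
  have hex : ∀ i, ∃ P, (IsPath E P ∧ IsFromTo P (s i) d) ∧
      ∀ Q, IsPath E Q ∧ IsFromTo Q (s i) d → pathLength y P ≤ pathLength y Q := by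
    intro i
    refine Set.exists_min_image {P | IsPath E P ∧ IsFromTo P (s i) d} (pathLength y)
      (Set.toFinite _) ?_
    by_contra hempty
    -- Without any path, zero lengths with `Z = 1` would give `∑ c ≤ 0`.
    have := mul_le_sum_of_cuts E 0 (s i) 1 (fun _ => le_rfl) d one_pos _
      (fun P h1 h2 => absurd ⟨P, h1, h2⟩ hempty) (hcut i)
    simp only [one_mul, Pi.zero_apply, Finset.sum_const_zero] at this
    exact absurd (hsum_pos i) this.not_gt
  choose P hP hPmin using hex
  have hPv := hv _ (subset_convexHull ℝ _ (Set.mem_image_of_mem (load c) (show P ∈ G from hP)))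
  rw [hf, sum_load_mul] at hPv
  have hy0 : 0 ≤ ∑ e, y e := Finset.sum_nonneg fun e _ => hy e
  rcases isEmpty_or_nonempty (Fin k) with hk | hk
  · rw [Finset.univ_eq_empty, Finset.sum_empty] at hPv
    linarith
  obtain ⟨i, hi⟩ := Finite.exists_max fun i => pathLength y (P i)
  have hle : ∑ j, c j * pathLength y (P j) ≤ pathLength y (P i) * ∑ j, c j := by
    rw [mul_comm, Finset.sum_mul]
    exact Finset.sum_le_sum fun j _ => mul_le_mul_of_nonneg_left (hi j) (hc j).le
  have hZ : 0 < pathLength y (P i) :=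
    pos_of_mul_pos_left (by linarith) (hsum_pos i).le
  have := mul_le_sum_of_cuts E y (s i) _ hy d hZ _ (fun Q h1 h2 => hPmin i Q ⟨h1, h2⟩) (hcut i)
  linarith

/-! ### Flooding against small cuts -/

/-- If all edges leaving a cut are faulty, then flooding stays inside the cut. -/
theorem floodSet_subset_of_isCut {V : Type*} [Fintype V] {T : ℕ} {E : ℕ → Set (V × V)}
    {fault : ℕ × V × V → Bool} {s d : V} {U : Fin (T + 1) → Set V} (hU : IsCut s d U)
    (hf : ∀ e ∈ cutEdges (fun t : Fin T => E t) U, fault (e.1, e.2) = true) (t : Fin (T + 1)) :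
    floodSet E fault {s} t ⊆ U t := by
  induction t using Fin.induction with
  | zero => simpa [floodSet] using hU.source_mem
  | succ t ih =>
    rintro v (hv | ⟨u, hu, huv, hfault⟩)
    · exact hU.mono t (ih hv)
    · by_contra hv
      have := hf (t, u, v) (by simpa [cutEdges] using ⟨huv, ih hu, hv⟩)
      simp [hfault] at this

theorem floodSet_mono {V : Type*} (E : ℕ → Set (V × V)) (fault : ℕ × V × V → Bool) (S : Set V) :
    Monotone (floodSet E fault S) :=
  monotone_nat_of_le_succ fun _ _ hv => Or.inl hv

theorem le_floodTime_of_notMem {V : Type*} {E : ℕ → Set (V × V)} {fault : ℕ × V × V → Bool}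
    {S : Set V} {d : V} {T : ℕ} (hd : d ∉ floodSet E fault S T) :
    ((T + 2 : ℕ) : ℕ∞) ≤ floodTime S (E, fault) := by
  refine le_iInf₂ fun t ht => ?_
  have : T < t := by
    by_contra! h
    exact hd (floodSet_mono E fault S h (ht ▸ Set.mem_univ d))
  exact_mod_cast (by omega : T + 2 ≤ t + 1)

theorem measure_faults {V : Type*} [Fintype V] (p : unitInterval) (F : Finset (ℕ × V × V)) :
    Measure.infinitePi (fun _ : ℕ × V × V => bernoulliMeasure true false p)
      {fault | ∀ e ∈ F, fault e = true} = ENNReal.ofReal (p : ℝ) ^ F.card := by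
  have : {fault : ℕ × V × V → Bool | ∀ e ∈ F, fault e = true} =
      Set.pi F fun _ => {true} := by
    ext
    simp
  rw [this, Measure.infinitePi_pi _ fun _ _ => measurableSet_singleton _, Finset.prod_const,
    bernoulliMeasure_apply_of_mem_of_notMem p (measurableSet_singleton _) (by simp) (by simp)]
  rw [ENNReal.ofReal_eq_coe_nnreal p.2.1]
  rfl

theorem measurableSet_of_restrict {V : Type*} [Finite V] {T : ℕ}
    (p : (Fin T → Set (V × V)) → Prop) :
    MeasurableSet {E : ℕ → Set (V × V) | p fun t : Fin T => E t} := by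
  have : Measurable fun (E : ℕ → Set (V × V)) (t : Fin T) => E t :=
    measurable_pi_lambda _ fun t => measurable_pi_apply _
  exact this (Set.toFinite {E | p E}).measurableSet

/-- A Fubini lower bound; passing to the measurable hull of `S` avoids proving the flooding event
measurable. -/
theorem mul_measure_le_measure_prod {X Y : Type*} [MeasurableSpace X] [MeasurableSpace Y]
    (μ : Measure X) (ν : Measure Y) [SFinite ν] {A : Set X} (S : Set (X × Y)) (b : ENNReal)
    (hA : MeasurableSet A) (h : ∀ x ∈ A, b ≤ ν (Prod.mk x ⁻¹' S)) : b * μ A ≤ μ.prod ν S := by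
  rw [← measure_toMeasurable S, Measure.prod_apply (measurableSet_toMeasurable _ _),
    ← setLIntegral_const]
  calc ∫⁻ _ in A, b ∂μ ≤ ∫⁻ x in A, ν (Prod.mk x ⁻¹' toMeasurable (μ.prod ν) S) ∂μ :=
        setLIntegral_mono' hA fun x hx =>
          (h x hx).trans (measure_mono (Set.preimage_mono (subset_toMeasurable _ _)))
    _ ≤ _ := setLIntegral_le_lintegral _ _

/-- The edge sets for which some cut between `s` and `d` has at most `N` edges. -/
def smallCut {V : Type*} [Fintype V] (T : ℕ) (s d : V) (N : ℕ) : Set (ℕ → Set (V × V)) :=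
  {E | ∃ U : Fin (T + 1) → Set V, IsCut s d U ∧ (cutEdges (fun t : Fin T => E t) U).card ≤ N}

theorem measurableSet_smallCut {V : Type*} [Fintype V] (T : ℕ) (s d : V) (N : ℕ) :
    MeasurableSet (smallCut T s d N) :=
  measurableSet_of_restrict fun E => ∃ U, IsCut s d U ∧ (cutEdges E U).card ≤ N

/-- Faults are independent of the edge sets, so for each fixed sequence with a small cut the edges
of that cut all fail with probability at least `p ^ N`. -/
theorem smallCut_le {V : Type*} [Fintype V] (M : ObliviousModel V) (p : unitInterval)
    (T : ℕ) (s d : V) (N : ℕ) :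
    (p : ℝ) ^ N * M.law.real (smallCut T s d N) ≤
      (M.floodLaw p).real {ω | ((T + 2 : ℕ) : ℕ∞) ≤ floodTime {s} ω} := by
  classical
  have := M.isProbabilityMeasure_law
  have hfin : M.floodLaw p {ω | ((T + 2 : ℕ) : ℕ∞) ≤ floodTime {s} ω} ≠ ⊤ := by
    unfold ObliviousModel.floodLaw
    exact measure_ne_top _ _
  have h : ENNReal.ofReal (p : ℝ) ^ N * M.law (smallCut T s d N) ≤
      M.floodLaw p {ω | ((T + 2 : ℕ) : ℕ∞) ≤ floodTime {s} ω} := by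
    refine mul_measure_le_measure_prod _ _ _ _ (measurableSet_smallCut T s d N) ?_
    rintro E ⟨U, hU, hcard⟩
    let F : Finset (ℕ × V × V) :=
      (cutEdges (fun t : Fin T => E t) U).image fun e => ((e.1 : ℕ), e.2)
    calc ENNReal.ofReal (p : ℝ) ^ N ≤ ENNReal.ofReal (p : ℝ) ^ F.card :=
          pow_le_pow_of_le_one zero_le (by simpa using p.2.2) (Finset.card_image_le.trans hcard)
      _ ≤ _ := by
          rw [← measure_faults]
          refine measure_mono fun fault hfault => le_floodTime_of_notMem (d := d) fun hd => ?_
          refine hU.sink_notMem (floodSet_subset_of_isCut (fault := fault) (E := E) hU ?_ _ hd)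
          exact fun e he => hfault _ (Finset.mem_image_of_mem _ he)
  have h2 := ENNReal.toReal_mono hfin h
  rwa [ENNReal.toReal_mul, ENNReal.toReal_pow, ENNReal.toReal_ofReal p.2.1] at h2

/-- A source is cut off from `d` by few edges with small probability. -/
theorem smallCut_lt {V : Type*} [Fintype V] {M : ObliviousModel V} {T α : ℝ} (hα : 0 < α)
    (hM : M.FloodsInTime T α) {T' : ℕ} {N : ℕ} {δ : ℝ} (hδ : 0 < δ) (hδ1 : δ ≤ 1) (s d : V)
    (hT' : T + 1 / α * ((N + 1 : ℝ) + Real.logb 2 δ⁻¹) ≤ T') :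
    M.law.real (smallCut T' s d N) ≤ δ := by
  obtain ⟨q, hq, hflood⟩ := hM
  have hq2 : (2 : ℝ) ≤ q := by exact_mod_cast hq.two_le
  have hq0 : (0 : ℝ) < q := by linarith
  set L := Real.logb 2 δ⁻¹ with hL
  have hL0 : 0 ≤ L := Real.logb_nonneg one_lt_two ((one_le_inv₀ hδ).2 hδ1)
  have hgap : (N + 1 : ℝ) + L ≤ α * (T' - T) := by
    have : 1 / α * ((N + 1 : ℝ) + L) ≤ T' - T := by linarith
    rwa [one_div, inv_mul_le_iff₀ hα] at this
  have hpos : 0 < T' - T := 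
    pos_of_mul_pos_right (lt_of_lt_of_le (by positivity) hgap) hα.le
  -- This is the largest `m` with `T + m ≤ T' + 2`; missing `d` after `T'` rounds means a flooding
  -- time of at least `T' + 2`, as time starts at 1.
  have hkpos : 0 < ⌊(T' - T) + 2⌋₊ := Nat.floor_pos.2 (by linarith)
  have hk1 : (⌊(T' - T) + 2⌋₊ : ℝ) ≤ T' - T + 2 := Nat.floor_le (by linarith)
  have hk2 := Nat.lt_floor_add_one ((T' - T) + 2)
  set m := ⌊(T' - T) + 2⌋₊
  have h1 := smallCut_le M (faultProb q) T' s d N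
  have h2 : (M.floodLaw (faultProb q)).real {ω | ((T' + 2 : ℕ) : ℕ∞) ≤ floodTime {s} ω} ≤
      (M.floodLaw (faultProb q)).real
        {ω | ENNReal.ofReal (T + m) ≤ (floodTime {s} ω : ENNReal)} := by
    have := M.isProbabilityMeasure_law
    unfold ObliviousModel.floodLaw
    refine measureReal_mono fun ω hω => ?_
    have h3 : (((T' + 2 : ℕ) : ℕ∞) : ENNReal) ≤ (floodTime {s} ω : ENNReal) := by
      exact_mod_cast (show ((T' + 2 : ℕ) : ℕ∞) ≤ floodTime {s} ω from hω)
    refine le_trans ?_ h3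
    rw [ENat.toENNReal_coe, ← ENNReal.ofReal_natCast]
    refine ENNReal.ofReal_le_ofReal ?_
    push_cast
    linarith
  have h3 : (q : ℝ) ^ (-(α * m)) ≤ (q : ℝ) ^ (-(N : ℝ)) * δ := by
    calc (q : ℝ) ^ (-(α * m)) ≤ (q : ℝ) ^ (-(N : ℝ) + -L) := by
          refine Real.rpow_le_rpow_of_exponent_le (by linarith) ?_
          nlinarith
      _ = (q : ℝ) ^ (-(N : ℝ)) * (q : ℝ) ^ (-L) := Real.rpow_add hq0 _ _
      _ ≤ (q : ℝ) ^ (-(N : ℝ)) * δ := by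
          refine mul_le_mul_of_nonneg_left ?_ (by positivity)
          -- Base 2 works for every prime power `q ≥ 2`, since `L ≥ 0` by `δ ≤ 1`.
          calc (q : ℝ) ^ (-L) ≤ 2 ^ (-L) :=
                Real.rpow_le_rpow_of_nonpos two_pos hq2 (by linarith)
            _ = δ := by
                rw [hL, Real.logb_inv, neg_neg,
                  Real.rpow_logb two_pos (by norm_num) hδ]
  have h4 : ((faultProb q : unitInterval) : ℝ) ^ N = (q : ℝ) ^ (-(N : ℝ)) := by
    rw [Real.rpow_neg hq0.le, Real.rpow_natCast]
    simp [faultProb]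
  rw [h4] at h1
  have h5 := hflood s m hkpos
  exact le_of_mul_le_mul_left (h1.trans (h2.trans (h5.le.trans h3))) (by positivity)

end NetworkGossip

/-! ### Union bound over the sources -/

theorem mainTheorem4 {V : Type*} [Fintype V] (M : NetworkGossip.ObliviousModel V)
    (T α : ℝ) (hα : 0 < α) (hM : M.FloodsInTime T α)
    (T' : ℕ) (ε : ℝ) (hε : 0 < ε) (d : V) (k : ℕ) (s : Fin k → V) (c : Fin k → ℝ)
    (hc : ∀ i, 0 < c i)
    (hT' : T + 1 / α * ((⌈∑ i, c i⌉ : ℝ) + Real.logb 2 k + Real.logb 2 ε⁻¹) ≤ T') :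
    1 - ε ≤ M.law.real
      {E | NetworkGossip.CapacitiesAchievable (fun t : Fin T' => E t) s d c} := by
  open NetworkGossip in
  have := M.isProbabilityMeasure_law
  rcases lt_or_ge 1 ε with hε1 | hε1
  · exact (by linarith : 1 - ε ≤ 0).trans measureReal_nonneg
  -- A cut with fewer than `∑ c` edges has at most this many.
  set N : ℕ := ⌈∑ i, c i⌉₊ - 1
  set B : Set (ℕ → Set (V × V)) := ⋃ i, smallCut T' (s i) d N
  have hB : MeasurableSet B := .iUnion fun i => measurableSet_smallCut T' (s i) d N
  have hsub : Bᶜ ⊆ {E | CapacitiesAchievable (fun t : Fin T' => E t) s d c} := by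
    intro E hE
    refine capacitiesAchievable_of_cuts hc fun i U hU => ?_
    by_contra! hlt
    refine hE (Set.mem_iUnion.2 ⟨i, U, hU, ?_⟩)
    have := Nat.lt_ceil.2 hlt
    omega
  have hBε : M.law.real B ≤ ε := by
    rcases Nat.eq_zero_or_pos k with rfl | hk
    · simp [B, hε.le]
    have hk1 : (1 : ℝ) ≤ k := by exact_mod_cast hk
    have hcpos : 0 < ∑ i, c i := Finset.sum_pos (fun i _ => hc i) ⟨⟨0, hk⟩, Finset.mem_univ _⟩
    have hN : (N + 1 : ℝ) = (⌈∑ i, c i⌉ : ℝ) := by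
      have h1 : N + 1 = ⌈∑ i, c i⌉₊ := Nat.sub_add_cancel (Nat.ceil_pos.2 hcpos)
      rw [← natCast_ceil_eq_intCast_ceil hcpos.le]
      exact_mod_cast h1
    -- Each source gets failure budget `ε / k`, whence the term `log₂ k`.
    have hi : ∀ i, M.law.real (smallCut T' (s i) d N) ≤ ε / k := by
      intro i
      refine smallCut_lt hα hM (by positivity) ((div_le_one (by linarith)).2 (hε1.trans hk1))
        _ _ ?_
      rw [hN, inv_div, div_eq_mul_inv (k : ℝ), Real.logb_mul (by positivity) (by positivity), ← add_assoc]
      exact hT'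
    calc M.law.real B ≤ ∑ i, M.law.real (smallCut T' (s i) d N) :=
          measureReal_iUnion_fintype_le _
      _ ≤ ∑ _i : Fin k, ε / k := Finset.sum_le_sum fun i _ => hi i
      _ = ε := by
          rw [Finset.sum_const, Finset.card_univ, Fintype.card_fin, nsmul_eq_mul]
          field_simp
  calc 1 - ε ≤ 1 - M.law.real B := by linarith
    _ = M.law.real Bᶜ := (probReal_compl_eq_one_sub hB).symm
    _ ≤ _ := measureReal_mono hsub
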